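/- Let $N$ be a lattice (a free abelian group of finite rank), $M=\operatorname{Hom}(N,\mathbb{Z})$, and let $\sigma\subset N\otimes\mathbb{R}$ be a strongly convex rational polyhedral cone with set of rays $\sigma(1)$; write $n(\rho)\in N$ for the primitive generator of $\rho\in\sigma(1)$. Put $\sigma_M=\{m\in M:\ m\ge 0 \text{ on } \sigma\}$, and $m\le_\sigma m'$ iff $m'-m\in\sigma_M$. Let $k$ be a field and $\mathbf{E}$ a finite-dimensional $k$-vector space with, for every $\rho\in\sigma(1)$, an increasing filtration $\cdots\subset E^\rho(i)\subset E^\rho(i+1)\subset\cdots\subset\mathbf{E}$ $(i\in\mathbb{Z})$ by subspaces that is full, i.e. $E^\rho(i)=0$ for $i\ll 0$ and $E^\rho(i)=\mathbf{E}$ for $i\gg 0$. Let $E^\sigma=\bigoplus_{m\in M}E^\sigma_m$ be the associated reflexive $M$-graded $k[\sigma_M]$-module, $$E^\sigma_m=\bigcap_{\rho\in\sigma(1)}E^\rho(\langle m,n(\rho)\rangle),$$ where for $m\le_\sigma m'$ multiplication by the monomial $\chi(m'-m)$ is the inclusion $E^\sigma_m\subset E^\sigma_{m'}$. (Thus $E^\sigma$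 is the same as the representation $m\mapsto E^\sigma_m$ of the preordered set $(M,\le_\sigma)$.) Let $\bar{\mathbb{Z}}=\mathbb{Z}\cup\{-\infty\}$, order $\bar{\mathbb{Z}}^{\sigma(1)}$ componentwise, and let $\hat 0=(-\infty,\dots,-\infty)$. Compare $m\in M$ with elements of $\bar{\mathbb{Z}}^{\sigma(1)}$ through its image $(\langle m,n(\rho)\rangle)_\rho$. For $m\in M$ define the anchor $$A(m)=\big(\min\{i\in\mathbb{Z}:\ E^\sigma_m\subset E^\rho(i)\}\big)_{\rho\in\sigma(1)}\in\bar{\mathbb{Z}}^{\sigma(1)},$$ where the minimum is read as $-\infty$ if the set is not bounded below. Let $\mathcal{P}_{E^\sigma}=\{A(m): m\in M\}$. A set $\mathcal{P}\subset\bar{\mathbb{Z}}^{\sigma(1)}$ is called an admissible poset with respect to an $M$-graded $k[\sigma_M]$-module $E$ if it is finite, $\mathcal{P}\subset\mathbb{Z}^{\sigma(1)}\cup\{\hat 0\}$, and (i) for every $m\in M$ there is a unique $\underline n\in\mathcal{P}$ with $\underline n\le m$ such that $\underline n'\le m$ implies $\underline n'\le\underline n$ for all $\underline n'\in\mathcal{P}$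 (let $T_{\underline n}$ be the set of all $m$ for which this element is $\underline n$); (ii) for every $\underline n\in\mathcal{P}$, with $U_{\underline n}=\bigcup_{m\in M,\ \underline n\le m}\{m'\in M: m\le_\sigma m'\}$, there are a $k$-vector space $E_{\underline n}$ and a $k$-linear map $E_{\underline n}\to\varprojlim_{m\in U_{\underline n}}E_m$ such that the induced map $E_{\underline n}\to E_m$ is an isomorphism for all $m\in T_{\underline n}$. Then: 1. If $E^\sigma_m\ne 0$, all the minima in the definition of $A(m)$ exist in $\mathbb{Z}$; if $E^\sigma_m=0$, then $A(m)=\hat 0$. 2. $\mathcal{P}_{E^\sigma}$ is an admissible poset with respect to $E^\sigma$. 3. For all $m,m'\in M$: $E^\sigma_m\subset E^\sigma_{m'}$ iff $A(m)\le A(m')$, and $E^\sigma_m=E^\sigma_{m'}$ iff $A(m)=A(m')$. 4. Consequently $E^\sigma_m\mapsto A(m)$ is a well-defined isomorphism of posets from the vector space arrangement $\{E^\sigma_m: m\in M\}$, ordered by inclusion, onto $\mathcal{P}_{E^\sigma}$. -/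

import Mathlib

open scoped TensorProduct
open CategoryTheory

universe v

noncomputable section

namespace ToricKlyachko

section Cone

variable {N : Type*} [AddCommGroup N]

/-- `σ ⊆ N_ℝ = ℝ ⊗ N` is a strongly convex rational polyhedral cone: it is generated by finitely
many lattice vectors and contains no line. -/
structure IsToricCone (σ : PointedCone ℝ (ℝ ⊗[ℤ] N)) : Prop where
  rational_polyhedral : ∃ S : Finset N,
    σ = PointedCone.hull ℝ ((fun n : N => (1 : ℝ) ⊗ₜ[ℤ] n) '' (S : Set N))
  strongly_convex : (σ : ConvexCone ℝ (ℝ ⊗[ℤ] N)).Salient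

/-- A lattice vector is primitive if it is only divisible by units
(in particular it is nonzero). -/
def IsPrimitive (n : N) : Prop :=
  ∀ (a : ℤ) (n' : N), n = a • n' → IsUnit a

/-- The set `σ(1)` of rays of `σ`. A ray `ρ` (a one-dimensional face spanned by a lattice vector)
is represented by its primitive generator `n(ρ)`. -/
def Rays (σ : PointedCone ℝ (ℝ ⊗[ℤ] N)) : Type _ :=
  {n : N // IsPrimitive n ∧
    (PointedCone.hull ℝ {(1 : ℝ) ⊗ₜ[ℤ] n}).IsFaceOf σ}

/-- The primitive generator `n(ρ)` of a ray. -/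
def primitiveGenerator {σ : PointedCone ℝ (ℝ ⊗[ℤ] N)} (ρ : Rays σ) : N := ρ.1

/-- The character lattice `M = Hom(N, ℤ)`, seen as the preordered set `(M, ≤_σ)`. -/
def CharLattice (_σ : PointedCone ℝ (ℝ ⊗[ℤ] N)) : Type _ := Module.Dual ℤ N

instance (σ : PointedCone ℝ (ℝ ⊗[ℤ] N)) : AddCommGroup (CharLattice σ) :=
  inferInstanceAs (AddCommGroup (Module.Dual ℤ N))

/-- `σ_M`, the submonoid of the `m ∈ M` that are nonnegative on all of `σ`. -/
def dualMonoid (σ : PointedCone ℝ (ℝ ⊗[ℤ] N)) : AddSubmonoid (CharLattice σ) where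
  carrier := {m | ∀ x ∈ σ, 0 ≤ Module.Dual.baseChange ℝ (show Module.Dual ℤ N from m) x}
  zero_mem' := fun x _ => by
    change 0 ≤ Module.Dual.baseChange ℝ (0 : Module.Dual ℤ N) x
    simp
  add_mem' := fun {a b} ha hb x hx => by
    change 0 ≤ Module.Dual.baseChange ℝ
      ((show Module.Dual ℤ N from a) + (show Module.Dual ℤ N from b)) x
    rw [map_add]
    exact add_nonneg (ha x hx) (hb x hx)

/-- `m ≤_σ m'` iff `m' - m ∈ σ_M`. -/
instance (σ : PointedCone ℝ (ℝ ⊗[ℤ] N)) : Preorder (CharLattice σ) where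
  le m m' := m' - m ∈ dualMonoid σ
  le_refl m := by
    show m - m ∈ dualMonoid σ
    rw [sub_self]
    exact zero_mem _
  le_trans a b c hab hbc := by
    have h := (dualMonoid σ).add_mem hbc hab
    rwa [sub_add_sub_cancel] at h

/-- The pairing `⟨m, n(ρ)⟩`. -/
def pairing {σ : PointedCone ℝ (ℝ ⊗[ℤ] N)} (m : CharLattice σ) (ρ : Rays σ) : ℤ :=
  (show Module.Dual ℤ N from m) (primitiveGenerator ρ)

theorem pairing_mono {σ : PointedCone ℝ (ℝ ⊗[ℤ] N)} {m m' : CharLattice σ} (h : m ≤ m')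
    (ρ : Rays σ) : pairing m ρ ≤ pairing m' ρ := by
  have h1 : (1 : ℝ) ⊗ₜ[ℤ] ρ.1 ∈ σ := ρ.2.2.le (Submodule.subset_span rfl)
  have h2 := h _ h1
  change 0 ≤ Module.Dual.baseChange ℝ
    ((show Module.Dual ℤ N from m') - (show Module.Dual ℤ N from m)) ((1 : ℝ) ⊗ₜ[ℤ] ρ.1) at h2
  rw [Module.Dual.baseChange_apply_tmul, LinearMap.sub_apply] at h2
  have h3 : (0 : ℝ) ≤ (((show Module.Dual ℤ N from m') ρ.1 -
      (show Module.Dual ℤ N from m) ρ.1 : ℤ) : ℝ) := by simpa using h2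
  have h4 := Int.cast_nonneg_iff.mp h3
  exact sub_nonneg.mp h4

/-- The map `M → ℤ^{σ(1)} ⊆ (ℤ ∪ {-∞})^{σ(1)}`, `m ↦ (⟨m, n(ρ)⟩)_ρ`, along which the elements of
`M` are compared with tuples indexed by rays. -/
def toTuple {σ : PointedCone ℝ (ℝ ⊗[ℤ] N)} (m : CharLattice σ) : Rays σ → WithBot ℤ :=
  fun ρ => (pairing m ρ : WithBot ℤ)

end Cone

section Admissible

variable {N : Type*} [AddCommGroup N] {σ : PointedCone ℝ (ℝ ⊗[ℤ] N)}
  {k : Type*} [Field k]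

/-- `n` is the unique greatest element of `P` below `m`. -/
def IsAnchor (P : Set (Rays σ → WithBot ℤ)) (n : Rays σ → WithBot ℤ) (m : CharLattice σ) : Prop :=
  n ∈ P ∧ n ≤ toTuple m ∧ ∀ n' ∈ P, n' ≤ toTuple m → n' ≤ n

/-- The equivalence class `T_n` of all `m ∈ M` whose anchor in `P` is `n`. -/
def anchorClass (P : Set (Rays σ → WithBot ℤ)) (n : Rays σ → WithBot ℤ) : Set (CharLattice σ) :=
  {m | IsAnchor P n m}

/-- The open set `U_n = ⋃_{n ≤ m} U(m)` of `M`, where `U(m) = {m' | m ≤_σ m'}`. -/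
def openSet (n : Rays σ → WithBot ℤ) : Set (CharLattice σ) :=
  ⋃ m ∈ {m : CharLattice σ | n ≤ toTuple m}, Set.Ici m

theorem anchorClass_subset_openSet (P : Set (Rays σ → WithBot ℤ)) (n : Rays σ → WithBot ℤ) :
    anchorClass P n ⊆ openSet n :=
  fun m hm => Set.mem_biUnion (show m ∈ {m : CharLattice σ | n ≤ toTuple m} from hm.2.1)
    Set.self_mem_Ici

/-- `E(U) = lim_{m ∈ U} E_m`, the sections over `U ⊆ M` of the sheaf given by a `σ`-family `E`
(a `k`-linear representation of the preordered set `(M, ≤_σ)`): compatible families of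
elements. -/
def familySections (E : CharLattice σ ⥤ ModuleCat k) (U : Set (CharLattice σ)) :
    Submodule k (∀ m : U, E.obj m.1) where
  carrier := {s | ∀ (m m' : U) (h : m.1 ≤ m'.1), (E.map (homOfLE h)).hom (s m) = s m'}
  zero_mem' := fun m m' h => by simp
  add_mem' := fun {a b} ha hb m m' h => by simp [ha m m' h, hb m m' h]
  smul_mem' := fun c a ha m m' h => by simp [ha m m' h]

/-- A set `P` of tuples is an admissible poset (with the componentwise order) with respect to the
`σ`-family `E`, equivalently the `M`-graded `k[σ_M]`-module `⨁ m, E_m`. -/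
structure IsAdmissible (P : Set (Rays σ → WithBot ℤ)) (E : CharLattice σ ⥤ ModuleCat.{v} k) :
    Prop where
  finite : P.Finite
  /-- `P` is contained in `ℤ^{σ(1)} ∪ {(-∞, …, -∞)}`. -/
  integral_or_bot : ∀ n ∈ P, (∀ ρ, n ρ ≠ ⊥) ∨ n = ⊥
  existsUnique_anchor : ∀ m : CharLattice σ, ∃! n, IsAnchor P n m
  /-- Each `n ∈ P` has an anchor completion `W = E_n`, with a homomorphism `δ` to `E(U_n)`
  inducing isomorphisms to `E_m` for all `m ∈ T_n`. -/
  anchor_completion : ∀ n ∈ P, ∃ (W : ModuleCat.{v} k) (δ : W →ₗ[k] familySections E (openSet n)),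
    ∀ (m : CharLattice σ) (hm : m ∈ anchorClass P n),
      Function.Bijective fun w : W => (δ w).1 ⟨m, anchorClass_subset_openSet P n hm⟩

end Admissible

section Klyachko

/-- A full filtration of `V`: an increasing `ℤ`-indexed filtration by subspaces which is `0` for
very small and `V` for very large indices. -/
structure FullFiltration (k : Type*) (V : Type*) [Field k] [AddCommGroup V] [Module k V] where
  toFun : ℤ → Submodule k V
  monotone : Monotone toFun
  eventually_bot : ∃ i₀, ∀ i ≤ i₀, toFun i = ⊥
  eventually_top : ∃ i₁, ∀ i, i₁ ≤ i → toFun i = ⊤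

variable {N : Type*} [AddCommGroup N] {σ : PointedCone ℝ (ℝ ⊗[ℤ] N)}
  {k : Type*} [Field k] {V : Type v} [AddCommGroup V] [Module k V]

/-- `E^σ_m = ⋂_{ρ ∈ σ(1)} E^ρ(⟨m, n(ρ)⟩)`. -/
def reflexivePiece (F : Rays σ → FullFiltration k V) (m : CharLattice σ) : Submodule k V :=
  ⨅ ρ : Rays σ, (F ρ).toFun (pairing m ρ)

theorem reflexivePiece_mono (F : Rays σ → FullFiltration k V) : Monotone (reflexivePiece F) :=
  fun _ _ h => iInf_mono fun ρ => (F ρ).monotone (pairing_mono h ρ)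

/-- The `σ`-family of the reflexive module `E^σ = ⨁_m E^σ_m` given by the filtrations `F`: for
`m ≤_σ m'`, multiplication by `χ(m' - m)` is the inclusion `E^σ_m ⊆ E^σ_{m'}`. -/
def reflexiveFamily (F : Rays σ → FullFiltration k V) : CharLattice σ ⥤ ModuleCat.{v} k where
  obj m := ModuleCat.of k (reflexivePiece F m)
  map f := ModuleCat.ofHom (Submodule.inclusion (reflexivePiece_mono F (leOfHom f)))

open Classical in
/-- `κ_ρ(m) = min {i ∈ ℤ | E^σ_m ⊆ E^ρ(i)}`, with value `-∞` if the set has no lower bound. The set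
is nonempty, so if it is bounded below then its infimum in `ℤ` is a minimum. -/
def kappa (F : Rays σ → FullFiltration k V) (m : CharLattice σ) (ρ : Rays σ) : WithBot ℤ :=
  if BddBelow {i : ℤ | reflexivePiece F m ≤ (F ρ).toFun i} then
    ((sInf {i : ℤ | reflexivePiece F m ≤ (F ρ).toFun i} : ℤ) : WithBot ℤ)
  else ⊥

/-- The anchor `A(m) = (κ_ρ(m))_ρ`. -/
def anchor (F : Rays σ → FullFiltration k V) (m : CharLattice σ) : Rays σ → WithBot ℤ :=
  fun ρ => kappa F m ρ

/-- The canonical admissible poset `{A(m) | m ∈ M}`. -/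
def canonicalPoset (F : Rays σ → FullFiltration k V) : Set (Rays σ → WithBot ℤ) :=
  Set.range (anchor F)

/-- The vector space arrangement `{E^σ_m | m ∈ M}`, ordered by inclusion. -/
def arrangement (F : Rays σ → FullFiltration k V) : Set (Submodule k V) :=
  Set.range (reflexivePiece F)

end Klyachko

end ToricKlyachko

end

open ToricKlyachko

namespace ToricKlyachko

/-! ### Finiteness of the set of rays. -/

section Rays

variable {N : Type*} [AddCommGroup N]

/-! Everything rests on `anchor_le_toTuple_iff`: `A(m) ≤ m'` iff `E_m ⊆ E_{m'}`. As `E_{m'}` is an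
intersection over the rays, the inclusion is tested ray by ray, where `E_m ⊆ E^ρ(j)` iff `j` is at
least the minimum. In particular `A(m) ≤ m`, so `A` reflects and preserves inclusions, `A(m)` is the
greatest anchor below `m`, and its class consists of the `m'` with `E_{m'} = E_m`; hence `E_m`
itself is an anchor completion. The poset is finite because each coordinate takes finitely many
values and there are finitely many rays (`IsToricCone.finite_rays`). -/

theorem IsPrimitive.ne_zero {n : N} (hn : IsPrimitive n) : n ≠ 0 := by
  rintro rfl
  exact not_isUnit_zero (hn 0 0 (by simp))

/-- Primitive lattice vectors on a common half-line are equal. -/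
theorem IsPrimitive.eq_of_dual_eq_mul [Module.Free ℤ N] {n n' : N} (hn : IsPrimitive n)
    (hn' : IsPrimitive n') {c : ℝ} (hc : 0 < c)
    (h : ∀ f : Module.Dual ℤ N, (f n : ℝ) = c * f n') : n = n' := by
  obtain ⟨f₀, hf₀⟩ : ∃ f : Module.Dual ℤ N, f n' ≠ 0 := by
    by_contra! H
    exact hn'.ne_zero ((Module.forall_dual_apply_eq_zero_iff ℤ n').1 H)
  -- The scalar `c` is `p / q` in lowest terms. Functionals separate points, so `q • n = p • n'`,
  -- and Bézout makes `n` divisible by `p` and `n'` by `q`.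
  obtain ⟨g, q, p, hg, hqp, hq, hp⟩ := Int.exists_gcd_one' (m := f₀ n') (n := f₀ n)
    (Int.gcd_pos_of_ne_zero_left _ hf₀)
  have hg0 : (g : ℤ) ≠ 0 := by exact_mod_cast hg.ne'
  have hgR : (g : ℝ) ≠ 0 := by exact_mod_cast hg.ne'
  have hpq : (p : ℝ) = c * q := by
    have h0 := h f₀
    rw [hp, hq] at h0
    push_cast at h0
    exact mul_right_cancel₀ hgR (by linarith)
  have hq0 : q ≠ 0 := by
    rintro rfl
    exact hf₀ (by simpa using hq)
  have hqn : q • n = p • n' := by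
    rw [← sub_eq_zero]
    refine (Module.forall_dual_apply_eq_zero_iff ℤ _).1 fun f => ?_
    have : ((q * f n - p * f n' : ℤ) : ℝ) = 0 := by
      push_cast
      rw [h f, hpq]
      ring
    simpa using Int.cast_eq_zero.1 this
  have hpos : 0 < p * q := by
    have : (0 : ℝ) < ((p * q : ℤ) : ℝ) := by
      push_cast
      rw [hpq, mul_assoc]
      exact mul_pos hc (mul_self_pos.2 (by exact_mod_cast hq0))
    exact_mod_cast this
  obtain ⟨u, v, huv⟩ := Int.isCoprime_iff_gcd_eq_one.2 hqp
  have hup : IsUnit p := hn p (u • n' + v • n) <| by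
    calc n = (u * q + v * p) • n := by rw [huv, one_smul]
      _ = u • (q • n) + (v * p) • n := by rw [add_smul, mul_smul]
      _ = p • (u • n' + v • n) := by rw [hqn]; module
  have huq : IsUnit q := hn' q (u • n' + v • n) <| by
    calc n' = (u * q + v * p) • n' := by rw [huv, one_smul]
      _ = (u * q) • n' + v • (p • n') := by rw [add_smul, mul_smul v]
      _ = q • (u • n' + v • n) := by rw [← hqn]; module
  -- Opposite signs are excluded by `hpos`.
  rcases Int.isUnit_iff.1 hup with rfl | rfl <;> rcases Int.isUnit_iff.1 huq with rfl | rfl <;>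
    simp_all

theorem baseChange_one_tmul (f : Module.Dual ℤ N) (n : N) :
    Module.Dual.baseChange ℝ f ((1 : ℝ) ⊗ₜ[ℤ] n) = (f n : ℝ) := by
  simp [Module.Dual.baseChange_apply_tmul]

/-- A ray of a cone generated by `S` contains an element of `S` in its relative interior. -/
theorem exists_generator_mem_ray [Module.Free ℤ N] {S : Finset N} {n : N} (hn : n ≠ 0)
    (hface : (PointedCone.hull ℝ {(1 : ℝ) ⊗ₜ[ℤ] n}).IsFaceOf
      (PointedCone.hull ℝ ((fun n : N => (1 : ℝ) ⊗ₜ[ℤ] n) '' (S : Set N)))) :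
    ∃ s ∈ S, ∃ c : ℝ, 0 < c ∧ ∀ f : Module.Dual ℤ N, (f s : ℝ) = c * f n := by
  have hmem := hface.le (Submodule.subset_span rfl)
  obtain ⟨c, hc⟩ := (Submodule.mem_span_image_finset_iff_exists_fun' _).1 hmem
  obtain ⟨f₀, hf₀⟩ : ∃ f : Module.Dual ℤ N, f n ≠ 0 := by
    by_contra! H
    exact hn ((Module.forall_dual_apply_eq_zero_iff ℤ n).1 H)
  have hsum : ∑ i ∈ S, (c i : ℝ) * f₀ i = f₀ n := by
    have := congrArg (Module.Dual.baseChange ℝ f₀) hc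
    rw [map_sum, baseChange_one_tmul] at this
    rw [← this]
    refine Finset.sum_congr rfl fun i _ => ?_
    rw [← baseChange_one_tmul, ← smul_eq_mul, ← map_smul]
    rfl
  -- The face property puts every generator with positive coefficient on the ray; `f₀ s ≠ 0` also
  -- keeps `s` away from the apex.
  obtain ⟨s, hs, hcs⟩ : ∃ s ∈ S, (c s : ℝ) * f₀ s ≠ 0 := by
    apply Finset.exists_ne_zero_of_sum_ne_zero
    rw [hsum]
    exact_mod_cast hf₀
  have hgen : ∀ i ∈ S, (1 : ℝ) ⊗ₜ[ℤ] i ∈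
      PointedCone.hull ℝ ((fun n : N => (1 : ℝ) ⊗ₜ[ℤ] n) '' (S : Set N)) :=
    fun i hi => Submodule.subset_span ⟨i, hi, rfl⟩
  have hcpos : (0 : ℝ) < c s := lt_of_le_of_ne (c s).2 (Ne.symm (left_ne_zero_of_mul hcs))
  classical
  have hsmem : (1 : ℝ) ⊗ₜ[ℤ] s ∈ PointedCone.hull ℝ {(1 : ℝ) ⊗ₜ[ℤ] n} := by
    refine hface.mem_of_smul_add_mem (y := ∑ i ∈ S.erase s, c i • ((1 : ℝ) ⊗ₜ[ℤ] i))
      (hgen s hs) (Submodule.sum_mem _ fun i hi =>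
        Submodule.smul_mem _ _ (hgen i (Finset.mem_of_mem_erase hi))) hcpos ?_
    have := Finset.add_sum_erase S (fun i => c i • ((1 : ℝ) ⊗ₜ[ℤ] i)) hs
    rw [hc] at this
    exact this ▸ Submodule.subset_span rfl
  obtain ⟨d, hd⟩ := Submodule.mem_span_singleton.1 hsmem
  have hval : ∀ f : Module.Dual ℤ N, (f s : ℝ) = (d : ℝ) * f n := fun f => by
    rw [← baseChange_one_tmul, ← hd, ← baseChange_one_tmul, ← smul_eq_mul, ← map_smul]
    rfl
  refine ⟨s, hs, d, lt_of_le_of_ne d.2 fun h0 => right_ne_zero_of_mul hcs ?_, hval⟩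
  rw [hval, ← h0, zero_mul]

/-- Choosing on each ray one of the finitely many generators is injective, since a half-line has
only one primitive vector. -/
theorem IsToricCone.finite_rays [Module.Free ℤ N] {σ : PointedCone ℝ (ℝ ⊗[ℤ] N)}
    (hσ : IsToricCone σ) : Finite (Rays σ) := by
  obtain ⟨S, rfl⟩ := hσ.rational_polyhedral
  choose s hs c hc h using fun ρ : Rays (PointedCone.hull ℝ
    ((fun n : N => (1 : ℝ) ⊗ₜ[ℤ] n) '' (S : Set N))) =>
      exists_generator_mem_ray ρ.2.1.ne_zero ρ.2.2
  refine Finite.of_injective (fun ρ => (⟨s ρ, hs ρ⟩ : S)) fun ρ ρ' hρ => Subtype.ext ?_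
  have hss : s ρ = s ρ' := congrArg Subtype.val hρ
  refine ρ.2.1.eq_of_dual_eq_mul ρ'.2.1 (mul_pos (inv_pos.2 (hc ρ)) (hc ρ')) fun f => ?_
  rw [mul_assoc, ← h ρ' f, ← hss, h ρ f, inv_mul_cancel_left₀ (hc ρ).ne']

end Rays

/-! ### Anchors and the canonical poset. -/

section Anchor

variable {N : Type*} [AddCommGroup N] {σ : PointedCone ℝ (ℝ ⊗[ℤ] N)}
  {k : Type*} [Field k] {V : Type v} [AddCommGroup V] [Module k V]

theorem FullFiltration.bddBelow_of_ne_bot (G : FullFiltration k V) {W : Submodule k V}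
    (hW : W ≠ ⊥) : BddBelow {i : ℤ | W ≤ G.toFun i} := by
  obtain ⟨i₀, h₀⟩ := G.eventually_bot
  refine ⟨i₀, fun i hi => ?_⟩
  by_contra! hlt
  exact hW (le_bot_iff.1 ((h₀ i hlt.le) ▸ hi))

theorem FullFiltration.nonempty_le (G : FullFiltration k V) (W : Submodule k V) :
    {i : ℤ | W ≤ G.toFun i}.Nonempty := by
  obtain ⟨i₁, h₁⟩ := G.eventually_top
  exact ⟨i₁, by simp [h₁ i₁ le_rfl]⟩

variable (F : Rays σ → FullFiltration k V)

theorem exists_anchor_eq_isLeast {m : CharLattice σ} (hm : reflexivePiece F m ≠ ⊥) (ρ : Rays σ) :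
    ∃ i : ℤ, anchor F m ρ = (i : WithBot ℤ) ∧
      IsLeast {j : ℤ | reflexivePiece F m ≤ (F ρ).toFun j} i := by
  have hb := (F ρ).bddBelow_of_ne_bot hm
  have hne := (F ρ).nonempty_le (reflexivePiece F m)
  exact ⟨sInf _, if_pos hb, Int.csInf_mem hne hb, fun i hi => csInf_le hb hi⟩

theorem anchor_eq_bot {m : CharLattice σ} (hm : reflexivePiece F m = ⊥) : anchor F m = ⊥ := by
  funext ρ
  refine if_neg ?_
  -- The zero subspace lies in every filtration step, so the index set is all of `ℤ`.
  simp [hm]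

theorem reflexivePiece_le_toFun (m : CharLattice σ) (ρ : Rays σ) :
    reflexivePiece F m ≤ (F ρ).toFun (pairing m ρ) :=
  iInf_le _ ρ

theorem anchor_le_toTuple_iff (m m' : CharLattice σ) :
    anchor F m ≤ toTuple m' ↔ reflexivePiece F m ≤ reflexivePiece F m' := by
  by_cases hm : reflexivePiece F m = ⊥
  · simp [hm, anchor_eq_bot F hm]
  · rw [Pi.le_def, reflexivePiece, reflexivePiece, le_iInf_iff]
    refine forall_congr' fun ρ => ?_
    obtain ⟨i, hi, hleast⟩ := exists_anchor_eq_isLeast F hm ρ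
    rw [hi, toTuple, WithBot.coe_le_coe]
    exact ⟨fun h => hleast.1.trans ((F ρ).monotone h), fun h => hleast.2 h⟩

theorem anchor_le_anchor_iff (m m' : CharLattice σ) :
    anchor F m ≤ anchor F m' ↔ reflexivePiece F m ≤ reflexivePiece F m' := by
  refine ⟨fun h => (anchor_le_toTuple_iff F m m').1
    (h.trans ((anchor_le_toTuple_iff F m' m').2 le_rfl)), fun h => ?_⟩
  by_cases hm : reflexivePiece F m = ⊥
  · simp [anchor_eq_bot F hm]
  · intro ρ
    obtain ⟨i, hi, hleast⟩ := exists_anchor_eq_isLeast F hm ρ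
    obtain ⟨i', hi', hleast'⟩ := exists_anchor_eq_isLeast F (ne_bot_of_le_ne_bot hm h) ρ
    rw [hi, hi', WithBot.coe_le_coe]
    -- An index whose step contains the larger subspace also competes in the minimum for the smaller
    -- one.
    exact hleast.2 (h.trans hleast'.1)

theorem anchor_eq_anchor_iff (m m' : CharLattice σ) :
    anchor F m = anchor F m' ↔ reflexivePiece F m = reflexivePiece F m' := by
  simp only [le_antisymm_iff, anchor_le_anchor_iff]

theorem isAnchor_canonicalPoset_iff (n : Rays σ → WithBot ℤ) (m : CharLattice σ) :
    IsAnchor (canonicalPoset F) n m ↔ n = anchor F m := by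
  have hself : IsAnchor (canonicalPoset F) (anchor F m) m := by
    refine ⟨Set.mem_range_self m, (anchor_le_toTuple_iff F m m).2 le_rfl, ?_⟩
    rintro _ ⟨m', rfl⟩ h
    exact (anchor_le_anchor_iff F m' m).2 ((anchor_le_toTuple_iff F m' m).1 h)
  refine ⟨fun h => le_antisymm (hself.2.2 n h.1 h.2.1) (h.2.2 _ hself.1 hself.2.1), ?_⟩
  rintro rfl
  exact hself

/-- A finite value lies between an index where the filtration is still zero and one where it is
already everything. -/
theorem finite_range_kappa (ρ : Rays σ) : (Set.range fun m => kappa F m ρ).Finite := by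
  obtain ⟨i₀, h₀⟩ := (F ρ).eventually_bot
  obtain ⟨i₁, h₁⟩ := (F ρ).eventually_top
  refine (((Set.finite_Icc i₀ i₁).image ((↑) : ℤ → WithBot ℤ)).insert ⊥).subset ?_
  rintro _ ⟨m, rfl⟩
  by_cases hm : reflexivePiece F m = ⊥
  · exact Or.inl (congrFun (anchor_eq_bot F hm) ρ)
  · obtain ⟨i, hi, hleast⟩ := exists_anchor_eq_isLeast F hm ρ
    refine Or.inr ⟨i, ⟨?_, hleast.2 (by simp [h₁ i₁ le_rfl])⟩, hi.symm⟩
    by_contra! hlt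
    exact hm (le_bot_iff.1 ((h₀ i hlt.le) ▸ hleast.1))

theorem finite_canonicalPoset [Finite (Rays σ)] : (canonicalPoset F).Finite :=
  (Set.Finite.pi' fun ρ => finite_range_kappa F ρ).subset <| by
    rintro _ ⟨m, rfl⟩ ρ
    exact ⟨m, rfl⟩

theorem reflexivePiece_le_of_mem_openSet {m₀ m : CharLattice σ}
    (hm : m ∈ openSet (anchor F m₀)) : reflexivePiece F m₀ ≤ reflexivePiece F m := by
  obtain ⟨m', hm', hle⟩ := Set.mem_iUnion₂.1 hm
  exact ((anchor_le_toTuple_iff F m₀ m').1 hm').trans (reflexivePiece_mono F hle)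

/-- The inclusions of `E^σ_{m₀}` into the pieces over the open set of its anchor. -/
def reflexiveSections (m₀ : CharLattice σ) :
    reflexivePiece F m₀ →ₗ[k] familySections (reflexiveFamily F) (openSet (anchor F m₀)) where
  toFun w := ⟨fun m => Submodule.inclusion (reflexivePiece_le_of_mem_openSet F m.2) w,
    fun _ _ _ => rfl⟩
  map_add' _ _ := rfl
  map_smul' _ _ := rfl

theorem isAdmissible_canonicalPoset [Finite (Rays σ)] :
    IsAdmissible (canonicalPoset F) (reflexiveFamily F) where
  finite := finite_canonicalPoset F
  integral_or_bot := by
    rintro _ ⟨m, rfl⟩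
    by_cases hm : reflexivePiece F m = ⊥
    · exact Or.inr (anchor_eq_bot F hm)
    · refine Or.inl fun ρ => ?_
      obtain ⟨i, hi, -⟩ := exists_anchor_eq_isLeast F hm ρ
      simp [hi]
  existsUnique_anchor m :=
    ⟨anchor F m, (isAnchor_canonicalPoset_iff F _ m).2 rfl,
      fun n hn => (isAnchor_canonicalPoset_iff F n m).1 hn⟩
  anchor_completion := by
    rintro _ ⟨m₀, rfl⟩
    refine ⟨ModuleCat.of k (reflexivePiece F m₀), reflexiveSections F m₀, fun m hm => ?_⟩
    have heq : reflexivePiece F m₀ = reflexivePiece F m :=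
      (anchor_eq_anchor_iff F m₀ m).1 ((isAnchor_canonicalPoset_iff F _ m).1 hm)
    refine ⟨Submodule.inclusion_injective heq.le, fun w => ?_⟩
    exact ⟨⟨w.1, heq.ge w.2⟩, rfl⟩

theorem exists_arrangement_orderIso :
    ∃ e : arrangement F ≃o canonicalPoset F, ∀ m : CharLattice σ,
      e ⟨reflexivePiece F m, Set.mem_range_self m⟩ = ⟨anchor F m, Set.mem_range_self m⟩ := by
  -- The choice of `m` representing a subspace is harmless: equal subspaces have equal anchors.
  choose r hr using fun W : arrangement F => W.2
  have hle (W W' : arrangement F) : anchor F (r W) ≤ anchor F (r W') ↔ W ≤ W' := by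
    rw [anchor_le_anchor_iff, hr, hr, Subtype.coe_le_coe]
  have hval (m : CharLattice σ) :
      anchor F (r ⟨reflexivePiece F m, Set.mem_range_self m⟩) = anchor F m :=
    (anchor_eq_anchor_iff F _ _).2 (hr _)
  refine ⟨RelIso.ofSurjective (OrderEmbedding.ofMapLEIff
    (fun W => (⟨anchor F (r W), Set.mem_range_self _⟩ : canonicalPoset F)) hle) ?_,
    fun m => Subtype.ext (hval m)⟩
  rintro ⟨_, m, rfl⟩
  exact ⟨⟨reflexivePiece F m, Set.mem_range_self m⟩, Subtype.ext (hval m)⟩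

end Anchor

end ToricKlyachko

theorem mainTheorem11 {N : Type*} [AddCommGroup N] [Module.Free ℤ N] [Module.Finite ℤ N]
    (σ : PointedCone ℝ (ℝ ⊗[ℤ] N)) (hσ : IsToricCone σ)
    {k : Type*} [Field k] {V : Type v} [AddCommGroup V] [Module k V] [FiniteDimensional k V]
    (F : Rays σ → FullFiltration k V) :
    (∀ m : CharLattice σ,
      (reflexivePiece F m ≠ ⊥ → ∀ ρ, ∃ i : ℤ, anchor F m ρ = (i : WithBot ℤ) ∧
        IsLeast {j : ℤ | reflexivePiece F m ≤ (F ρ).toFun j} i) ∧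
      (reflexivePiece F m = ⊥ → anchor F m = ⊥)) ∧
    IsAdmissible (canonicalPoset F) (reflexiveFamily F) ∧
    (∀ m m' : CharLattice σ,
      (reflexivePiece F m ≤ reflexivePiece F m' ↔ anchor F m ≤ anchor F m') ∧
      (reflexivePiece F m = reflexivePiece F m' ↔ anchor F m = anchor F m')) ∧
    ∃ e : arrangement F ≃o canonicalPoset F, ∀ m : CharLattice σ,
      e ⟨reflexivePiece F m, Set.mem_range_self m⟩ = ⟨anchor F m, Set.mem_range_self m⟩ := by
  have := hσ.finite_rays
  exact ⟨fun m => ⟨exists_anchor_eq_isLeast F, anchor_eq_bot F⟩, isAdmissible_canonicalPoset F,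
    fun m m' => ⟨(anchor_le_anchor_iff F m m').symm, (anchor_eq_anchor_iff F m m').symm⟩,
    exists_arrangement_orderIso F⟩
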